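/- \textbf{Setting.} Let $A$ be a countable set of atom sorts and let $(\mathbb{A}_\alpha)_{\alpha\in A}$ be pairwise disjoint countably infinite sets of atoms, $\mathbb{A}=\bigcup_\alpha\mathbb{A}_\alpha$. Let $\mathrm{Perm}_s$ be the group of permutations of $\mathbb{A}$ that move only finitely many atoms and map each $\mathbb{A}_\alpha$ to itself. A \emph{nominal set} is a set with an action of $\mathrm{Perm}_s$ in which every element $x$ is finitely supported, i.e. there is a finite $S\subseteq\mathbb{A}$ such that $\pi\cdot x=x$ whenever $\pi$ fixes every atom in $S$. The least such $S$ is $\mathrm{supp}(x)$, and $a\mathrel{\#}x$ means $a\notin\mathrm{supp}(x)$. $\mathbf{Nom}$ is the category of nominal sets and equivariant functions. For a nominal set $X$, $[\mathbb{A}_\alpha]X$ is the nominal set of all atom abstractions $\langle a\rangle x=\{(b,(b\;a)\cdot x)\mid b\in\mathbb{A}_\alpha,\ b=a\text{ or }b\mathrel{\#}x\}$ with $a\in\mathbb{A}_\alpha$, $x\in X$. A \emph{nominal signature} $\Sigma$ over $A$ consists of finitely many base sorts $\delta_1,\dots,\delta_n$ and, for each $i$, finitely many function symbols $f_{ij}:\sigma_{ij}\to\delta_i$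 ($1\le j\le m_i$), where the $\sigma_{ij}$ are \emph{nominal sorts}, given by $\sigma::=\delta_i\mid\alpha\mid[\alpha]\sigma\mid\sigma_1\times\cdots\times\sigma_k$ ($\alpha\in A$, $k\ge 0$). For $S=(S_1,\dots,S_n)\in\mathbf{Nom}^n$ put $[\![\delta_i]\!]S=S_i$, $[\![\alpha]\!]S=\mathbb{A}_\alpha$, $[\![[\alpha]\sigma]\!]S=[\mathbb{A}_\alpha]([\![\sigma]\!]S)$, $[\![\sigma_1\times\cdots\times\sigma_k]\!]S=\prod_l[\![\sigma_l]\!]S$. The \emph{nominal algebraic functor} $T:\mathbf{Nom}^n\to\mathbf{Nom}^n$ has components $T_iS=[\![\sigma_{i1}]\!]S+\cdots+[\![\sigma_{im_i}]\!]S$, and acts correspondingly on equivariant functions. A \emph{$\Sigma$-structure} $M$ consists of nominal sets $M[\![\delta_i]\!]$, extended to all sorts by $M[\![\sigma]\!]=[\![\sigma]\!](M[\![\delta_1]\!],\dots,M[\![\delta_n]\!])$, and equivariant functions $M[\![f_{ij}]\!]:M[\![\sigma_{ij}]\!]\to M[\![\delta_i]\!]$. It induces the $T$-algebra with carrier $(M[\![\delta_i]\!])_i$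 and structure map $\mathrm{inj}_j\,s\mapsto M[\![f_{ij}]\!](s)$. The $\Sigma$-structure $\mathit{NT}$ of \emph{nominal terms} is given by the least tuple of sets, with respect to pointwise inclusion, such that $\mathit{NT}[\![\delta_i]\!]=\mathit{NT}[\![\sigma_{i1}]\!]+\cdots+\mathit{NT}[\![\sigma_{im_i}]\!]$ for all $i$, with $\mathit{NT}[\![f_{ij}]\!]=\mathrm{inj}_j$. \emph{Raw terms} over $\Sigma$ are the sorted terms $t::=a\mid[a]t\mid(t_1,\dots,t_k)\mid f_{ij}(t)$, where $a\in\mathbb{A}_\alpha$ has sort $\alpha$, $[a]t$ has sort $[\alpha]\sigma$ if $a\in\mathbb{A}_\alpha$ and $t$ has sort $\sigma$, tuples have product sorts, and $f_{ij}(t)$ has sort $\delta_i$ if $t$ has sort $\sigma_{ij}$. Permutations act on all atoms of a raw term. \emph{Alpha-equivalence} $=_\alpha$ is the least relation between raw terms of the same sort that contains all $a=_\alpha a$, is compatible with tuples and function symbols, and satisfies $[a_1]t_1=_\alpha[a_2]t_2$ whenever $(a_1\;c)\cdot t_1=_\alpha(a_2\;c)\cdot t_2$ for some atom $c$ of the sort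 of $a_1,a_2$ with $c\mathrel{\#}(a_1,t_1,a_2,t_2)$. The \emph{nominal algebraic datatype} of sort $\sigma$ is the nominal set of $=_\alpha$-classes of raw terms of sort $\sigma$. A raw term $t$ of sort $\sigma$ has an interpretation $M[\![t]\!]\in M[\![\sigma]\!]$, given by $M[\![a]\!]=a$, $M[\![[a]t]\!]=\langle a\rangle M[\![t]\!]$, $M[\![(t_1,\dots,t_k)]\!]=(M[\![t_1]\!],\dots,M[\![t_k]\!])$, $M[\![f_{ij}(t)]\!]=M[\![f_{ij}]\!](M[\![t]\!])$. \textbf{Theorem.} Let $\Sigma$ be a nominal signature. \begin{enumerate} \item The $T$-algebra induced by $\mathit{NT}$ is an initial $T$-algebra. \item For each sort $\sigma$, the nominal set $\mathit{NT}[\![\sigma]\!]$ of nominal terms is isomorphic in $\mathbf{Nom}$ to the nominal algebraic datatype of sort $\sigma$; these isomorphisms can be chosen such that, for every sort $\sigma$ and every raw term $t$ of sort $\sigma$, $\mathit{NT}[\![t]\!]$ is sent to the $=_\alpha$-class of $t$. \end{enumerate} -/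

import Mathlib

universe u

noncomputable section

namespace NominalTerms

open CategoryTheory
open scoped Pointwise

variable {A : Type u} {𝔸 : A → Type u}

/-! ## Sorted atoms, finite permutations, nominal sets

`A` is the set of atom sorts and `𝔸 α` the set of atoms of sort `α`; the set of all atoms is the
disjoint union `Σ α, 𝔸 α`. A permutation of it that respects sorts is the same thing as a family of
permutations of the `𝔸 α`. -/

/-- The group of finite permutations of the atoms that respect the sorting. -/
def permSubgroup (𝔸 : A → Type u) : Subgroup (∀ α, Equiv.Perm (𝔸 α)) where
  carrier := {π | {p : Σ α, 𝔸 α | π p.1 p.2 ≠ p.2}.Finite}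
  one_mem' := by simp
  mul_mem' := by
    intro π ρ hπ hρ
    refine (Set.Finite.union hπ hρ).subset ?_
    intro p hp
    by_contra hcon
    simp only [Set.mem_union, Set.mem_ofPred_eq, not_or, not_not] at hcon
    exact hp (by simp [hcon.1, hcon.2])
  inv_mem' := by
    intro π hπ
    refine Set.Finite.subset hπ ?_
    intro p hp hcon
    exact hp (by
      change (π p.1)⁻¹ p.2 = p.2
      rw [Equiv.Perm.inv_eq_iff_eq, hcon])

abbrev SPerm (𝔸 : A → Type u) : Type u := ↥(permSubgroup 𝔸)

/-- Permutations act on the atoms of each sort by application. -/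
instance atomAction (α : A) : MulAction (SPerm 𝔸) (𝔸 α) where
  smul π a := π.1 α a
  one_smul _ := rfl
  mul_smul _ _ _ := rfl

open Classical in
/-- The transposition of two atoms of the same sort. -/
def swap {α : A} (a b : 𝔸 α) : SPerm 𝔸 :=
  ⟨Pi.mulSingle α (Equiv.swap a b), by
    refine Set.Finite.subset (Set.toFinite {(⟨α, a⟩ : Σ α, 𝔸 α), ⟨α, b⟩}) ?_
    rintro ⟨β, c⟩ hc
    by_cases hβ : β = α
    · subst hβ
      simp only [Set.mem_ofPred_eq, Pi.mulSingle_eq_same, ne_eq] at hc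
      by_contra hcon
      simp only [Set.mem_insert_iff, Sigma.mk.injEq, heq_eq_eq, true_and,
        Set.mem_singleton_iff, not_or] at hcon
      exact hc (Equiv.swap_apply_of_ne_of_ne hcon.1 hcon.2)
    · exact absurd (by simp [Pi.mulSingle_eq_of_ne hβ]) hc⟩

section Support

variable {X Y : Type u} [MulAction (SPerm 𝔸) X] [MulAction (SPerm 𝔸) Y]

/-- A set of atoms supports `x` if every permutation fixing all its elements fixes `x`. -/
def Supports (S : Set (Σ α, 𝔸 α)) (x : X) : Prop :=
  ∀ π : SPerm 𝔸, (∀ p ∈ S, π.1 p.1 p.2 = p.2) → π • x = x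

variable (𝔸) in
def FinSupported (x : X) : Prop := ∃ S : Set (Σ α, 𝔸 α), S.Finite ∧ Supports S x

variable (𝔸) in
/-- The support of `x`: the least finite set supporting it. -/
def supp (x : X) : Set (Σ α, 𝔸 α) := ⋂₀ {S | S.Finite ∧ Supports S x}

/-- The atom `a` is fresh in `x`. -/
def Fresh {α : A} (a : 𝔸 α) (x : X) : Prop := (⟨α, a⟩ : Σ α, 𝔸 α) ∉ supp 𝔸 x

/-- The set `⟨a⟩x = {(b, (b a) • x) | b = a ∨ b # x}`. -/
def absSet {α : A} (a : 𝔸 α) (x : X) : Set (𝔸 α × X) :=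
  {p | (p.1 = a ∨ Fresh p.1 x) ∧ p.2 = swap p.1 a • x}

theorem fresh_iff {α : A} {a : 𝔸 α} {x : X} :
    Fresh a x ↔ ∃ S : Set (Σ α, 𝔸 α), S.Finite ∧ Supports S x ∧ (⟨α, a⟩ : Σ α, 𝔸 α) ∉ S := by
  simp [Fresh, supp]

theorem swap_smul_left {α : A} (a b : 𝔸 α) : swap a b • a = b := by
  classical
  change (Pi.mulSingle α (Equiv.swap a b) : ∀ α, Equiv.Perm (𝔸 α)) α a = b
  simp

theorem swap_smul_right {α : A} (a b : 𝔸 α) : swap a b • b = a := by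
  classical
  change (Pi.mulSingle α (Equiv.swap a b) : ∀ α, Equiv.Perm (𝔸 α)) α b = a
  simp

theorem swap_smul_of_ne {α : A} {a b c : 𝔸 α} (h : c ≠ a) (h' : c ≠ b) : swap a b • c = c := by
  classical
  change (Pi.mulSingle α (Equiv.swap a b) : ∀ α, Equiv.Perm (𝔸 α)) α c = c
  simp [Equiv.swap_apply_of_ne_of_ne h h']

theorem swap_fix {α : A} {a b : 𝔸 α} (p : Σ α, 𝔸 α) (h : p ≠ ⟨α, a⟩) (h' : p ≠ ⟨α, b⟩) :
    (swap a b).1 p.1 p.2 = p.2 := by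
  classical
  obtain ⟨β, c⟩ := p
  by_cases hβ : β = α
  · subst hβ
    exact swap_smul_of_ne (fun e => h (congrArg (Sigma.mk β) e))
      (fun e => h' (congrArg (Sigma.mk β) e))
  · change (Pi.mulSingle α (Equiv.swap a b) : ∀ α, Equiv.Perm (𝔸 α)) β c = c
    simp [Pi.mulSingle_eq_of_ne hβ]

theorem swap_comm {α : A} (a b : 𝔸 α) : swap a b = swap b a := by
  classical
  apply Subtype.ext
  simp [swap, Equiv.swap_comm]

theorem swap_self {α : A} (a : 𝔸 α) : swap a a = 1 := by
  classical
  apply Subtype.ext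
  change (Pi.mulSingle α (Equiv.swap a a) : ∀ α, Equiv.Perm (𝔸 α)) = 1
  rw [Equiv.swap_self]
  exact Pi.mulSingle_one α

theorem conj_swap (π : SPerm 𝔸) {α : A} (a b : 𝔸 α) :
    π * swap a b = swap (π • a) (π • b) * π := by
  classical
  apply Subtype.ext
  funext β
  by_cases hβ : β = α
  · subst hβ
    change π.1 β * (Pi.mulSingle β (Equiv.swap a b) : ∀ α, Equiv.Perm (𝔸 α)) β
      = (Pi.mulSingle β (Equiv.swap (π.1 β a) (π.1 β b)) : ∀ α, Equiv.Perm (𝔸 α)) β * π.1 β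
    rw [Pi.mulSingle_eq_same, Pi.mulSingle_eq_same, Equiv.mul_swap_eq_swap_mul]
  · change π.1 β * (Pi.mulSingle α (Equiv.swap a b) : ∀ α, Equiv.Perm (𝔸 α)) β
      = (Pi.mulSingle α (Equiv.swap (π.1 α a) (π.1 α b)) : ∀ α, Equiv.Perm (𝔸 α)) β * π.1 β
    rw [Pi.mulSingle_eq_of_ne hβ, Pi.mulSingle_eq_of_ne hβ, one_mul, mul_one]

theorem conj_swap_smul (π : SPerm 𝔸) {α : A} (a b : 𝔸 α) (x : X) :
    π • swap a b • x = swap (π • a) (π • b) • π • x := by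
  rw [← mul_smul, conj_swap, mul_smul]

theorem swap_swap_smul {α : A} (a b : 𝔸 α) (x : X) : swap a b • swap a b • x = x := by
  classical
  rw [← mul_smul]
  have : swap a b * swap a b = (1 : SPerm 𝔸) := by
    apply Subtype.ext
    change (Pi.mulSingle α (Equiv.swap a b) : ∀ α, Equiv.Perm (𝔸 α)) *
      Pi.mulSingle α (Equiv.swap a b) = 1
    rw [← Pi.mulSingle_mul, Equiv.swap_mul_self, Pi.mulSingle_one]
  rw [this, one_smul]

theorem Supports.smul {S : Set (Σ α, 𝔸 α)} {x : X} (h : Supports S x) (π : SPerm 𝔸) :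
    Supports ((fun p => (⟨p.1, π.1 p.1 p.2⟩ : Σ α, 𝔸 α)) '' S) (π • x) := by
  intro ρ hρ
  have h1 : (π⁻¹ * ρ * π) • x = x := by
    apply h
    intro p hp
    have := hρ _ ⟨p, hp, rfl⟩
    change (π.1 p.1)⁻¹ (ρ.1 p.1 (π.1 p.1 p.2)) = p.2
    rw [Equiv.Perm.inv_eq_iff_eq]
    exact this
  rw [mul_assoc, mul_smul, mul_smul, inv_smul_eq_iff] at h1
  exact h1

theorem Supports.map {S : Set (Σ α, 𝔸 α)} {x : X} (h : Supports S x) (f : X →[SPerm 𝔸] Y) :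
    Supports S (f x) := by
  intro π hπ
  rw [← map_smul, h π hπ]

theorem FinSupported.smul {x : X} (h : FinSupported 𝔸 x) (π : SPerm 𝔸) :
    FinSupported 𝔸 (π • x) := by
  obtain ⟨S, hS, hx⟩ := h
  exact ⟨_, hS.image _, hx.smul π⟩

theorem FinSupported.map {x : X} (h : FinSupported 𝔸 x) (f : X →[SPerm 𝔸] Y) :
    FinSupported 𝔸 (f x) := by
  obtain ⟨S, hS, hx⟩ := h
  exact ⟨S, hS, hx.map f⟩

theorem Fresh.map {α : A} {a : 𝔸 α} {x : X} (h : Fresh a x) (f : X →[SPerm 𝔸] Y) :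
    Fresh a (f x) := by
  rw [fresh_iff] at h ⊢
  obtain ⟨S, hS, hx, ha⟩ := h
  exact ⟨S, hS, hx.map f, ha⟩

theorem Fresh.smul {α : A} {a : 𝔸 α} {x : X} (h : Fresh a x) (π : SPerm 𝔸) :
    Fresh (π • a) (π • x) := by
  rw [fresh_iff] at h ⊢
  obtain ⟨S, hS, hx, ha⟩ := h
  refine ⟨_, hS.image _, hx.smul π, ?_⟩
  rintro ⟨⟨β, b⟩, hb, hab⟩
  obtain ⟨rfl, hab⟩ := Sigma.mk.inj_iff.1 hab
  have hab := eq_of_heq hab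
  have : b = a := (π.1 β).injective hab
  exact ha (this ▸ hb)

theorem fresh_smul_iff {α : A} {a : 𝔸 α} {x : X} (π : SPerm 𝔸) :
    Fresh (π • a) (π • x) ↔ Fresh a x := by
  refine ⟨fun h => ?_, fun h => h.smul π⟩
  simpa using h.smul π⁻¹

theorem exists_not_mem [∀ α, Infinite (𝔸 α)] (α : A) {S : Set (Σ α, 𝔸 α)} (hS : S.Finite) :
    ∃ c : 𝔸 α, (⟨α, c⟩ : Σ α, 𝔸 α) ∉ S := by
  have : (Sigma.mk α ⁻¹' S).Finite := hS.preimage (sigma_mk_injective.injOn)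
  obtain ⟨c, hc⟩ := this.exists_notMem
  exact ⟨c, hc⟩

theorem exists_fresh [∀ α, Infinite (𝔸 α)] (α : A) {T : Set (𝔸 α)} (hT : T.Finite)
    {x y z : X} (hx : FinSupported 𝔸 x) (hy : FinSupported 𝔸 y) (hz : FinSupported 𝔸 z) :
    ∃ c : 𝔸 α, c ∉ T ∧ Fresh c x ∧ Fresh c y ∧ Fresh c z := by
  obtain ⟨S, hS, hx⟩ := hx
  obtain ⟨S', hS', hy⟩ := hy
  obtain ⟨S'', hS'', hz⟩ := hz
  obtain ⟨c, hc⟩ :=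
    exists_not_mem α (((hS.union hS').union hS'').union (hT.image (Sigma.mk α)))
  simp only [Set.mem_union, not_or] at hc
  exact ⟨c, fun h => hc.2 ⟨c, h, rfl⟩, fresh_iff.2 ⟨S, hS, hx, hc.1.1.1⟩,
    fresh_iff.2 ⟨S', hS', hy, hc.1.1.2⟩, fresh_iff.2 ⟨S'', hS'', hz, hc.1.2⟩⟩

theorem swap_fresh [∀ α, Infinite (𝔸 α)] {α : A} {a b : 𝔸 α} {x : X}
    (ha : Fresh a x) (hb : Fresh b x) : swap a b • x = x := by
  by_cases hab : a = b
  · subst hab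
    rw [swap_self, one_smul]
  rw [fresh_iff] at ha hb
  obtain ⟨S, hS, hx, ha⟩ := ha
  obtain ⟨S', hS', hx', hb⟩ := hb
  obtain ⟨c, hc⟩ := exists_not_mem α
    ((hS.union hS').union (Set.toFinite {(⟨α, a⟩ : Σ α, 𝔸 α), ⟨α, b⟩}))
  simp only [Set.mem_union, Set.mem_insert_iff, Set.mem_singleton_iff, Sigma.mk.injEq, heq_eq_eq,
    true_and, not_or] at hc
  obtain ⟨⟨hcS, hcS'⟩, hca, hcb⟩ := hc
  have h1 : swap a c • x = x :=
    hx _ fun p hp => swap_fix p (fun h => ha (h ▸ hp)) (fun h => hcS (h ▸ hp))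
  have h2 : swap c b • x = x :=
    hx' _ fun p hp => swap_fix p (fun h => hcS' (h ▸ hp)) (fun h => hb (h ▸ hp))
  have h3 := conj_swap_smul (swap a c) c b x
  rw [swap_smul_right, swap_smul_of_ne (Ne.symm hab) (Ne.symm hcb), h1, h2, h1] at h3
  exact h3.symm

theorem mem_absSet_self {α : A} (a : 𝔸 α) (x : X) : (a, x) ∈ absSet a x :=
  ⟨Or.inl rfl, by simp [swap_self]⟩

theorem absSet_swap [∀ α, Infinite (𝔸 α)] {α : A} {a b : 𝔸 α} {x : X} (hb : Fresh b x) :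
    absSet b (swap b a • x) = absSet a x := by
  have key : ∀ (a b : 𝔸 α) (x : X), Fresh b x → absSet b (swap b a • x) ⊆ absSet a x := by
    rintro a b x hb ⟨c, z⟩ ⟨hc, hz⟩
    simp only at hc hz
    subst hz
    by_cases hcb : c = b
    · subst hcb
      exact ⟨Or.inr hb, by simp [swap_self]⟩
    by_cases hca : c = a
    · subst hca
      refine ⟨Or.inl rfl, ?_⟩
      simp only
      rw [swap_comm c b, swap_swap_smul, swap_self, one_smul]
    have hcx : Fresh c x := by
      have := (hc.resolve_left hcb).smul (swap b a)
      rwa [swap_swap_smul, swap_smul_of_ne hcb hca] at this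
    refine ⟨Or.inr hcx, ?_⟩
    simp only
    by_cases hba : b = a
    · subst hba
      rw [swap_self, one_smul]
    rw [conj_swap_smul, swap_smul_right, swap_smul_of_ne (Ne.symm hca) (Ne.symm hba),
      swap_fresh hcx hb]
  refine Set.Subset.antisymm (key a b x hb) ?_
  have h1 : Fresh a (swap b a • x) := by
    have := hb.smul (swap b a)
    rwa [swap_smul_left] at this
  have h2 := key b a (swap b a • x) h1
  rwa [swap_comm a b, swap_swap_smul] at h2

theorem absSet_smul {α : A} (π : SPerm 𝔸) (a : 𝔸 α) (x : X) :
    π • absSet a x = absSet (π • a) (π • x) := by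
  ext ⟨b, y⟩
  rw [Set.mem_smul_set_iff_inv_smul_mem]
  simp only [absSet, Set.mem_ofPred_eq, Prod.smul_mk]
  have e1 : π⁻¹ • b = a ↔ b = π • a := inv_smul_eq_iff
  have e2 : Fresh (π⁻¹ • b) x ↔ Fresh b (π • x) := by
    rw [← fresh_smul_iff π, smul_inv_smul]
  have e3 : π⁻¹ • y = swap (π⁻¹ • b) a • x ↔ y = swap b (π • a) • π • x := by
    rw [inv_smul_eq_iff, conj_swap_smul, smul_inv_smul]
  rw [e1, e2, e3]

end Support

/-! ## The category of nominal sets -/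

variable (𝔸) in
/-- A nominal set: a set with an action of the finite permutations all of whose elements are
finitely supported. -/
structure Nom : Type (u + 1) where
  carrier : Type u
  [action : MulAction (SPerm 𝔸) carrier]
  finSupported : ∀ x : carrier, FinSupported 𝔸 x

namespace Nom

instance : CoeSort (Nom 𝔸) (Type u) := ⟨Nom.carrier⟩

instance (X : Nom 𝔸) : MulAction (SPerm 𝔸) X := X.action

/-- Morphisms of nominal sets are the equivariant functions. -/
instance : Category (Nom 𝔸) where
  Hom X Y := X →[SPerm 𝔸] Y
  id X := MulActionHom.id (SPerm 𝔸)
  comp f g := MulActionHom.comp g f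

/-- The equivariant function underlying a morphism. -/
def fn {X Y : Nom 𝔸} (f : X ⟶ Y) : X →[SPerm 𝔸] Y := f

/-- The nominal set of atoms of sort `α`. -/
def atoms (α : A) : Nom 𝔸 where
  carrier := 𝔸 α
  finSupported a := ⟨{⟨α, a⟩}, Set.finite_singleton _, fun _ hπ => hπ _ rfl⟩

/-- Finite products, with the componentwise action. -/
def prod {k : ℕ} (X : Fin k → Nom 𝔸) : Nom 𝔸 where
  carrier := ∀ i, X i
  finSupported x := by
    choose S hS hx using fun i => (X i).finSupported (x i)
    refine ⟨⋃ i, S i, Set.finite_iUnion hS, fun π hπ => funext fun i => ?_⟩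
    exact hx i π fun p hp => hπ p (Set.mem_iUnion_of_mem i hp)

def prodMap {k : ℕ} {X Y : Fin k → Nom 𝔸} (f : ∀ i, X i ⟶ Y i) : prod X ⟶ prod Y where
  toFun x i := fn (f i) (x i)
  map_smul' π x := funext fun i => map_smul (fn (f i)) π (x i)

instance sigmaAction {J : Type} (X : J → Nom 𝔸) : MulAction (SPerm 𝔸) (Σ j, X j) where
  smul π x := ⟨x.1, π • x.2⟩
  one_smul x := Sigma.ext rfl (heq_of_eq (one_smul _ x.2))
  mul_smul π ρ x := Sigma.ext rfl (heq_of_eq (mul_smul π ρ x.2))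

/-- Coproducts (disjoint unions). -/
def sum {J : Type} (X : J → Nom 𝔸) : Nom 𝔸 where
  carrier := Σ j, X j
  finSupported x := by
    obtain ⟨S, hS, hx⟩ := (X x.1).finSupported x.2
    exact ⟨S, hS, fun π hπ => Sigma.ext rfl (heq_of_eq (hx π hπ))⟩

def sumMap {J : Type} {X Y : J → Nom 𝔸} (f : ∀ j, X j ⟶ Y j) : sum X ⟶ sum Y where
  toFun x := ⟨x.1, fn (f x.1) x.2⟩
  map_smul' π x := Sigma.ext rfl (heq_of_eq (map_smul (fn (f x.1)) π x.2))

def sumDesc {J : Type} {X : J → Nom 𝔸} {Y : Nom 𝔸} (f : ∀ j, X j ⟶ Y) : sum X ⟶ Y where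
  toFun x := fn (f x.1) x.2
  map_smul' π x := map_smul (fn (f x.1)) π x.2

/-- The atom abstractions `⟨a⟩x` with `a` of sort `α` and `x ∈ X`. -/
def AbsCarrier (α : A) (X : Nom 𝔸) : Type u :=
  {C : Set (𝔸 α × X) // ∃ (a : 𝔸 α) (x : X), C = absSet a x}

instance absAction (α : A) (X : Nom 𝔸) : MulAction (SPerm 𝔸) (AbsCarrier α X) where
  smul π C := ⟨π • C.1, by
    obtain ⟨_, a, x, rfl⟩ := C
    exact ⟨π • a, π • x, absSet_smul π a x⟩⟩
  one_smul C := Subtype.ext (one_smul _ C.1)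
  mul_smul π ρ C := Subtype.ext (mul_smul π ρ C.1)

def absMk {α : A} {X : Nom 𝔸} (a : 𝔸 α) (x : X) : AbsCarrier α X := ⟨absSet a x, a, x, rfl⟩

theorem smul_absMk {α : A} {X : Nom 𝔸} (π : SPerm 𝔸) (a : 𝔸 α) (x : X) :
    π • absMk a x = absMk (π • a) (π • x) := Subtype.ext (absSet_smul π a x)

theorem exists_absMk {α : A} {X : Nom 𝔸} (C : AbsCarrier α X) : ∃ a x, C = absMk a x := by
  obtain ⟨_, a, x, rfl⟩ := C
  exact ⟨a, x, rfl⟩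

/-- The nominal set `[𝔸_α]X` of atom abstractions. -/
def abs (α : A) (X : Nom 𝔸) : Nom 𝔸 where
  carrier := AbsCarrier α X
  finSupported C := by
    obtain ⟨a, x, rfl⟩ := exists_absMk C
    obtain ⟨S, hS, hx⟩ := X.finSupported x
    refine ⟨insert ⟨α, a⟩ S, hS.insert _, fun π hπ => ?_⟩
    have h1 : π • a = a := hπ ⟨α, a⟩ (Set.mem_insert _ _)
    rw [smul_absMk, hx π fun p hp => hπ p (Set.mem_insert_of_mem _ hp), h1]

/-- Functions out of `[𝔸_α]X` from functions of a representative. -/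
def absLift {α : A} {X : Nom 𝔸} {Z : Type u} (F : 𝔸 α → X → Z) (C : AbsCarrier α X) : Z :=
  F (exists_absMk C).choose (exists_absMk C).choose_spec.choose

theorem absLift_mk {α : A} {X : Nom 𝔸} {Z : Type u} {F : 𝔸 α → X → Z}
    (hF : ∀ a b x, Fresh b x → F b (swap b a • x) = F a x) (a : 𝔸 α) (x : X) :
    absLift F (absMk a x) = F a x := by
  have h := (exists_absMk (absMk a x)).choose_spec.choose_spec
  rw [absLift]
  generalize (exists_absMk (absMk a x)).choose_spec.choose = y at h ⊢
  generalize (exists_absMk (absMk a x)).choose = b at h ⊢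
  have hmem : (b, y) ∈ absSet a x := by
    rw [show absSet a x = absSet b y from congrArg Subtype.val h]
    exact mem_absSet_self b y
  obtain ⟨hb, hy⟩ := hmem
  simp only at hb hy
  subst hy
  rcases hb with rfl | hb
  · rw [swap_self, one_smul]
  · exact hF a b x hb

variable [∀ α, Infinite (𝔸 α)]

/-- The action of `[𝔸_α](-)` on morphisms: `⟨a⟩x ↦ ⟨a⟩(f x)`. -/
def absMap (α : A) {X Y : Nom 𝔸} (f : X ⟶ Y) : abs α X ⟶ abs α Y where
  toFun := absLift fun a x => absMk a (fn f x)
  map_smul' π C := by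
    have hF : ∀ (a b : 𝔸 α) (x : X), Fresh b x →
        absMk b (fn f (swap b a • x)) = absMk a (fn f x) := by
      intro a b x hb
      apply Subtype.ext
      simp only [absMk, map_smul]
      exact absSet_swap (hb.map (fn f))
    obtain ⟨a, x, rfl⟩ := exists_absMk C
    refine (congrArg _ (smul_absMk π a x)).trans ((absLift_mk hF _ _).trans ?_)
    refine Eq.trans ?_ (congrArg (π • ·) (absLift_mk hF a x).symm)
    refine Eq.trans ?_ (smul_absMk π a (fn f x)).symm
    rw [map_smul]

theorem absMap_mk {α : A} {X Y : Nom 𝔸} (f : X ⟶ Y) (a : 𝔸 α) (x : X) :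
    fn (absMap α f) (absMk a x) = absMk a (fn f x) := by
  refine absLift_mk (F := fun a x => absMk a (fn f x)) ?_ a x
  intro a b x hb
  apply Subtype.ext
  simp only [absMk, map_smul]
  exact absSet_swap (hb.map (fn f))

end Nom

/-! ## Nominal signatures -/

/-- Nominal sorts over the base sorts `δ_i`, `i < n`, and the atom sorts in `A`. -/
inductive NSort (n : ℕ) (A : Type u) : Type u
  | base (i : Fin n) : NSort n A
  | atom (α : A) : NSort n A
  | abs (α : A) (σ : NSort n A) : NSort n A
  | prod (k : ℕ) (σ : Fin k → NSort n A) : NSort n A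

/-- A nominal signature with atom sorts in `A`: `n` base sorts `δ_i`, and for each of them `m i`
function symbols `f_ij : σ_ij → δ_i`, where `σ_ij = arity i j`. -/
structure Signature (A : Type u) : Type u where
  n : ℕ
  m : Fin n → ℕ
  arity : (i : Fin n) → Fin (m i) → NSort n A

/-! ## The nominal algebraic functor and `Σ`-structures -/

section Functor

variable {n : ℕ}

/-- The nominal set `⟦σ⟧S` for a tuple `S` of nominal sets. -/
def sortObj (S : Fin n → Nom 𝔸) : NSort n A → Nom 𝔸
  | .base i => S i
  | .atom α => Nom.atoms α
  | .abs α σ => Nom.abs α (sortObj S σ)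
  | .prod _ σ => Nom.prod fun l => sortObj S (σ l)

variable [∀ α, Infinite (𝔸 α)]

/-- `⟦σ⟧` on tuples of equivariant functions. -/
def sortMap {S S' : Fin n → Nom 𝔸} (f : ∀ i, S i ⟶ S' i) :
    ∀ σ : NSort n A, sortObj S σ ⟶ sortObj S' σ
  | .base i => f i
  | .atom α => 𝟙 (Nom.atoms α)
  | .abs α σ => Nom.absMap α (sortMap f σ)
  | .prod _ σ => Nom.prodMap fun l => sortMap f (σ l)

theorem sortMap_id (S : Fin n → Nom 𝔸) (σ : NSort n A) :
    sortMap (fun i => 𝟙 (S i)) σ = 𝟙 (sortObj S σ) := by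
  induction σ with
  | base i => rfl
  | atom α => rfl
  | abs α σ ih =>
    apply MulActionHom.ext
    intro C
    obtain ⟨a, x, rfl⟩ := Nom.exists_absMk C
    refine (Nom.absMap_mk _ a x).trans ?_
    rw [ih]
    rfl
  | prod k σ ih =>
    apply MulActionHom.ext
    intro x
    funext l
    change Nom.fn (sortMap (fun i => 𝟙 (S i)) (σ l)) (x l) = x l
    rw [ih l]
    rfl

theorem sortMap_comp {S S' S'' : Fin n → Nom 𝔸} (f : ∀ i, S i ⟶ S' i) (g : ∀ i, S' i ⟶ S'' i)
    (σ : NSort n A) : sortMap (fun i => f i ≫ g i) σ = sortMap f σ ≫ sortMap g σ := by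
  induction σ with
  | base i => rfl
  | atom α => rfl
  | abs α σ ih =>
    apply MulActionHom.ext
    intro C
    obtain ⟨a, x, rfl⟩ := Nom.exists_absMk C
    refine (Nom.absMap_mk _ a x).trans ?_
    change _ = Nom.fn (Nom.absMap α (sortMap g σ)) (Nom.fn (Nom.absMap α (sortMap f σ)) _)
    rw [Nom.absMap_mk, Nom.absMap_mk, ih]
    rfl
  | prod k σ ih =>
    apply MulActionHom.ext
    intro x
    funext l
    change Nom.fn (sortMap (fun i => f i ≫ g i) (σ l)) (x l) = _
    rw [ih l]
    rfl

variable (𝔸) in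
/-- The nominal algebraic functor `T` of a signature, with components
`T_i S = ⟦σ_i1⟧S + ⋯ + ⟦σ_im_i⟧S`. -/
def algFunctor (Sg : Signature A) : (Fin Sg.n → Nom 𝔸) ⥤ (Fin Sg.n → Nom 𝔸) where
  obj S i := Nom.sum fun j => sortObj S (Sg.arity i j)
  map f i := Nom.sumMap fun j => sortMap f (Sg.arity i j)
  map_id S := by
    funext i
    apply MulActionHom.ext
    rintro ⟨j, x⟩
    refine Sigma.ext rfl (heq_of_eq ?_)
    exact congrArg (fun h => Nom.fn h x) (sortMap_id S (Sg.arity i j))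
  map_comp f g := by
    funext i
    apply MulActionHom.ext
    rintro ⟨j, x⟩
    refine Sigma.ext rfl (heq_of_eq ?_)
    exact congrArg (fun h => Nom.fn h x) (sortMap_comp f g (Sg.arity i j))

variable (𝔸) in
/-- A `Σ`-structure: nominal sets for the base sorts and equivariant functions for the function
symbols. -/
structure SigmaStructure (Sg : Signature A) : Type (u + 1) where
  carrier : Fin Sg.n → Nom 𝔸
  op : ∀ (i : Fin Sg.n) (j : Fin (Sg.m i)), sortObj carrier (Sg.arity i j) ⟶ carrier i

/-- The nominal set `M⟦σ⟧`. -/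
def SigmaStructure.interp {Sg : Signature A} (M : SigmaStructure 𝔸 Sg) (σ : NSort Sg.n A) :
    Nom 𝔸 := sortObj M.carrier σ

/-- The `T`-algebra induced by a `Σ`-structure: `inj_j s ↦ M⟦f_ij⟧ s`. -/
def SigmaStructure.toAlgebra {Sg : Signature A} (M : SigmaStructure 𝔸 Sg) :
    Endofunctor.Algebra (algFunctor 𝔸 Sg) where
  a := M.carrier
  str i := Nom.sumDesc fun j => M.op i j

end Functor

/-! ## The `Σ`-structure of nominal terms

The sets of nominal terms are the least tuple of sets, with respect to inclusion, that satisfies the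
equations `D_i = ⟦σ_i1⟧D + ⋯ + ⟦σ_im_i⟧D`. All the sets in question consist of elements of the
following universe, which is closed under atoms, finite tuples, injections into disjoint unions and
partial functions from atoms (the atom abstraction `⟨a⟩x = {(b, (b a) • x) | b = a ∨ b # x}` being
the graph of a partial function). -/

variable (𝔸) in
inductive Univ : Type u
  | atom {α : A} (a : 𝔸 α) : Univ
  | tup {k : ℕ} (v : Fin k → Univ) : Univ
  | inj (j : ℕ) (x : Univ) : Univ
  | pfun {α : A} (dom : 𝔸 α → Prop) (g : ∀ b, dom b → Univ) : Univ

namespace Univ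

theorem pfun_ext {α : A} {dom dom' : 𝔸 α → Prop} {g : ∀ b, dom b → Univ 𝔸}
    {g' : ∀ b, dom' b → Univ 𝔸} (h : ∀ b, dom b ↔ dom' b) (hg : ∀ b h h', g b h = g' b h') :
    pfun dom g = pfun dom' g' := by
  obtain rfl : dom = dom' := funext fun b => propext (h b)
  congr 1
  funext b hb
  exact hg b hb hb

def act (π : SPerm 𝔸) : Univ 𝔸 → Univ 𝔸
  | .atom a => .atom (π • a)
  | .tup v => .tup fun l => act π (v l)
  | .inj j x => .inj j (act π x)
  | .pfun dom g => .pfun (fun b => dom (π⁻¹ • b)) (fun b h => act π (g (π⁻¹ • b) h))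

instance : MulAction (SPerm 𝔸) (Univ 𝔸) where
  smul π x := act π x
  one_smul x := by
    change act 1 x = x
    induction x with
    | atom a => rfl
    | tup v ih => exact congrArg _ (funext ih)
    | inj j x ih => exact congrArg _ ih
    | pfun dom g ih => exact congrArg _ (funext fun b => funext fun h => ih b h)
  mul_smul π ρ x := by
    change act (π * ρ) x = act π (act ρ x)
    induction x with
    | atom a => rfl
    | tup v ih => exact congrArg _ (funext ih)
    | inj j x ih => exact congrArg _ ih
    | pfun dom g ih =>
      refine pfun_ext (fun b => ?_) (fun b h h' => ?_)
      · rw [mul_inv_rev, mul_smul]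
      · exact ih _ h

/-- The atom abstraction `⟨a⟩x` as an element of the universe. -/
def absOf {α : A} (a : 𝔸 α) (x : Univ 𝔸) : Univ 𝔸 :=
  .pfun (fun b => b = a ∨ Fresh b x) (fun b _ => swap b a • x)

theorem smul_absOf {α : A} (π : SPerm 𝔸) (a : 𝔸 α) (x : Univ 𝔸) :
    π • absOf a x = absOf (π • a) (π • x) := by
  refine pfun_ext (fun b => ?_) (fun b h h' => ?_)
  · change (π⁻¹ • b = a ∨ Fresh (π⁻¹ • b) x) ↔ _
    rw [inv_smul_eq_iff, ← fresh_smul_iff π, smul_inv_smul]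
  · change π • swap (π⁻¹ • b) a • x = swap b (π • a) • π • x
    rw [conj_swap_smul, smul_inv_smul]

theorem absOf_swap [∀ α, Infinite (𝔸 α)] {α : A} {a b : 𝔸 α} {x : Univ 𝔸} (hb : Fresh b x) :
    absOf b (swap b a • x) = absOf a x := by
  have h := absSet_swap (a := a) hb
  have h' : ∀ p, p ∈ absSet b (swap b a • x) ↔ p ∈ absSet a x := fun p => by rw [h]
  refine pfun_ext (fun c => ?_) (fun c hc hc' => ?_)
  · exact ⟨fun hc => ((h' (c, swap c b • swap b a • x)).1 ⟨hc, rfl⟩).1,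
      fun hc => ((h' (c, swap c a • x)).2 ⟨hc, rfl⟩).1⟩
  · exact ((h' (c, swap c b • swap b a • x)).1 ⟨hc, rfl⟩).2

end Univ

section NT

variable {n : ℕ}

/-- The set `⟦σ⟧X` of elements of the universe, for a tuple `X` of such sets. -/
def sortSet (X : Fin n → Set (Univ 𝔸)) : NSort n A → Set (Univ 𝔸)
  | .base i => X i
  | .atom α => {u | ∃ a : 𝔸 α, u = .atom a}
  | .abs α σ => {u | ∃ a : 𝔸 α, ∃ x ∈ sortSet X σ, u = Univ.absOf a x}
  | .prod k σ => {u | ∃ v : Fin k → Univ 𝔸, (∀ l, v l ∈ sortSet X (σ l)) ∧ u = .tup v}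

theorem sortSet_mono {X Y : Fin n → Set (Univ 𝔸)} (h : X ≤ Y) (σ : NSort n A) :
    sortSet X σ ⊆ sortSet Y σ := by
  induction σ with
  | base i => exact h i
  | atom α => exact subset_rfl
  | abs α σ ih =>
    rintro u ⟨a, x, hx, rfl⟩
    exact ⟨a, x, ih hx, rfl⟩
  | prod k σ ih =>
    rintro u ⟨v, hv, rfl⟩
    exact ⟨v, fun l => ih l (hv l), rfl⟩

variable (𝔸) in
/-- The monotone operator `X ↦ (⟦σ_i1⟧X + ⋯ + ⟦σ_im_i⟧X)_i` on tuples of sets. -/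
def sumOp (Sg : Signature A) : (Fin Sg.n → Set (Univ 𝔸)) →o (Fin Sg.n → Set (Univ 𝔸)) where
  toFun X i := {u | ∃ j : Fin (Sg.m i), ∃ s ∈ sortSet X (Sg.arity i j), u = .inj j s}
  monotone' := by
    rintro X Y h i u ⟨j, s, hs, rfl⟩
    exact ⟨j, s, sortSet_mono h _ hs, rfl⟩

variable (𝔸) in
/-- The least tuple of sets satisfying the equations. -/
def leastTuple (Sg : Signature A) : Fin Sg.n → Set (Univ 𝔸) := (sumOp 𝔸 Sg).lfp

theorem sortSet_good {X : Fin n → Set (Univ 𝔸)} (σ : NSort n A) :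
    sortSet (fun i => {u | (∀ π : SPerm 𝔸, π • u ∈ X i) ∧ FinSupported 𝔸 u}) σ ⊆
      {u | (∀ π : SPerm 𝔸, π • u ∈ sortSet X σ) ∧ FinSupported 𝔸 u} := by
  induction σ with
  | base i => exact subset_rfl
  | atom α =>
    rintro u ⟨a, rfl⟩
    exact ⟨fun π => ⟨π • a, rfl⟩, {⟨α, a⟩}, Set.finite_singleton _,
      fun π hπ => congrArg Univ.atom (hπ _ rfl)⟩
  | abs α σ ih =>
    rintro u ⟨a, x, hx, rfl⟩
    obtain ⟨h1, S, hS, hx⟩ := ih hx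
    refine ⟨fun π => ⟨π • a, π • x, h1 π, Univ.smul_absOf π a x⟩, insert ⟨α, a⟩ S, hS.insert _,
      fun π hπ => ?_⟩
    have h1 : π • a = a := hπ ⟨α, a⟩ (Set.mem_insert _ _)
    rw [Univ.smul_absOf, hx π fun p hp => hπ p (Set.mem_insert_of_mem _ hp), h1]
  | prod k σ ih =>
    rintro u ⟨v, hv, rfl⟩
    refine ⟨fun π => ⟨fun l => π • v l, fun l => (ih l (hv l)).1 π, rfl⟩, ?_⟩
    choose S hS hx using fun l => (ih l (hv l)).2
    refine ⟨⋃ l, S l, Set.finite_iUnion hS, fun π hπ => congrArg Univ.tup (funext fun l => ?_)⟩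
    exact hx l π fun p hp => hπ p (Set.mem_iUnion_of_mem l hp)

theorem leastTuple_good (Sg : Signature A) (i : Fin Sg.n) {u : Univ 𝔸}
    (hu : u ∈ leastTuple 𝔸 Sg i) :
    (∀ π : SPerm 𝔸, π • u ∈ leastTuple 𝔸 Sg i) ∧ FinSupported 𝔸 u := by
  have key : leastTuple 𝔸 Sg ≤ fun i =>
      {u | (∀ π : SPerm 𝔸, π • u ∈ leastTuple 𝔸 Sg i) ∧ FinSupported 𝔸 u} := by
    apply OrderHom.lfp_le
    rintro i u ⟨j, s, hs, rfl⟩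
    obtain ⟨h1, S, hS, h2⟩ := sortSet_good _ hs
    refine ⟨fun π => ?_, S, hS, fun π hπ => congrArg (Univ.inj j) (h2 π hπ)⟩
    rw [leastTuple, ← OrderHom.map_lfp]
    exact ⟨j, π • s, h1 π, rfl⟩
  exact key i hu

instance leastTupleAction (Sg : Signature A) (i : Fin Sg.n) :
    MulAction (SPerm 𝔸) ↥(leastTuple 𝔸 Sg i) where
  smul π u := ⟨π • u.1, (leastTuple_good Sg i u.2).1 π⟩
  one_smul u := Subtype.ext (one_smul _ u.1)
  mul_smul π ρ u := Subtype.ext (mul_smul π ρ u.1)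

variable (𝔸) in
/-- The nominal set `NT⟦δ_i⟧`. -/
def ntBase (Sg : Signature A) (i : Fin Sg.n) : Nom 𝔸 where
  carrier := ↥(leastTuple 𝔸 Sg i)
  finSupported u := by
    obtain ⟨S, hS, h⟩ := (leastTuple_good Sg i u.2).2
    exact ⟨S, hS, fun π hπ => Subtype.ext (h π hπ)⟩

variable [∀ α, Infinite (𝔸 α)]

/-- An element of `⟦σ⟧(NT⟦δ_1⟧, …, NT⟦δ_n⟧)` as an element of the universe. -/
def ntVal (Sg : Signature A) :
    ∀ σ : NSort Sg.n A, sortObj (ntBase 𝔸 Sg) σ →[SPerm 𝔸] Univ 𝔸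
  | .base i => { toFun := fun (u : ↥(leastTuple 𝔸 Sg i)) => u.1, map_smul' := fun _ _ => rfl }
  | .atom α => { toFun := fun (a : 𝔸 α) => Univ.atom a, map_smul' := fun _ _ => rfl }
  | .abs α σ =>
    { toFun := Nom.absLift fun a x => Univ.absOf a (ntVal Sg σ x)
      map_smul' := fun π C => by
        have hF : ∀ (a b : 𝔸 α) (x : sortObj (ntBase 𝔸 Sg) σ), Fresh b x →
            Univ.absOf b (ntVal Sg σ (swap b a • x)) = Univ.absOf a (ntVal Sg σ x) := by
          intro a b x hb
          rw [map_smul, Univ.absOf_swap (hb.map (ntVal Sg σ))]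
        obtain ⟨a, x, rfl⟩ := Nom.exists_absMk C
        change Nom.absLift _ (π • Nom.absMk a x) = π • Nom.absLift _ (Nom.absMk a x)
        rw [Nom.smul_absMk, Nom.absLift_mk hF, Nom.absLift_mk hF, Univ.smul_absOf, map_smul] }
  | .prod _ σ =>
    { toFun := fun (x : ∀ l, sortObj (ntBase 𝔸 Sg) (σ l)) =>
        Univ.tup fun l => ntVal Sg (σ l) (x l)
      map_smul' := fun π x =>
        congrArg Univ.tup (funext fun l => map_smul (ntVal Sg (σ l)) π (x l)) }

theorem ntVal_mem (Sg : Signature A) (σ : NSort Sg.n A) (x : sortObj (ntBase 𝔸 Sg) σ) :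
    ntVal Sg σ x ∈ sortSet (leastTuple 𝔸 Sg) σ := by
  induction σ with
  | base i => exact Subtype.property (p := (· ∈ leastTuple 𝔸 Sg i)) x
  | atom α => exact ⟨x, rfl⟩
  | abs α σ ih => exact ⟨_, _, ih _, rfl⟩
  | prod k σ ih => exact ⟨_, fun l => ih l _, rfl⟩

variable (𝔸) in
/-- The `Σ`-structure of nominal terms; `f_ij` is interpreted as the `j`-th injection. -/
def NT (Sg : Signature A) : SigmaStructure 𝔸 Sg where
  carrier := ntBase 𝔸 Sg
  op i j :=
    { toFun := fun x => (⟨.inj j (ntVal Sg _ x), by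
        rw [leastTuple, ← OrderHom.map_lfp]
        exact ⟨j, _, ntVal_mem Sg _ x, rfl⟩⟩ : ↥(leastTuple 𝔸 Sg i))
      map_smul' := fun π x =>
        Subtype.ext (congrArg (Univ.inj j) (map_smul (ntVal Sg _) π x)) }

end NT

/-! ## Nominal algebraic datatypes: raw terms up to alpha-equivalence -/

/-- Raw terms (without variables and delayed renamings) of each sort. -/
inductive Raw (𝔸 : A → Type u) (Sg : Signature A) : NSort Sg.n A → Type u
  | atom {α : A} (a : 𝔸 α) : Raw 𝔸 Sg (.atom α)
  | abs {α : A} {σ : NSort Sg.n A} (a : 𝔸 α) (t : Raw 𝔸 Sg σ) : Raw 𝔸 Sg (.abs α σ)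
  | tup {k : ℕ} {σ : Fin k → NSort Sg.n A} (t : ∀ l, Raw 𝔸 Sg (σ l)) : Raw 𝔸 Sg (.prod k σ)
  | op (i : Fin Sg.n) (j : Fin (Sg.m i)) (t : Raw 𝔸 Sg (Sg.arity i j)) : Raw 𝔸 Sg (.base i)

namespace Raw

variable {Sg : Signature A}

def act (π : SPerm 𝔸) : ∀ {σ : NSort Sg.n A}, Raw 𝔸 Sg σ → Raw 𝔸 Sg σ
  | _, .atom a => .atom (π • a)
  | _, .abs a t => .abs (π • a) (act π t)
  | _, .tup t => .tup fun l => act π (t l)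
  | _, .op i j t => .op i j (act π t)

instance (σ : NSort Sg.n A) : MulAction (SPerm 𝔸) (Raw 𝔸 Sg σ) where
  smul π t := act π t
  one_smul t := by
    change act 1 t = t
    induction t with
    | atom a => rfl
    | abs a t ih => exact congrArg _ ih
    | tup t ih => exact congrArg _ (funext ih)
    | op i j t ih => exact congrArg _ ih
  mul_smul π ρ t := by
    change act (π * ρ) t = act π (act ρ t)
    induction t with
    | atom a => rfl
    | abs a t ih => exact congrArg (Raw.abs _) ih
    | tup t ih => exact congrArg _ (funext ih)
    | op i j t ih => exact congrArg _ ih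

theorem finSupported {σ : NSort Sg.n A} (t : Raw 𝔸 Sg σ) : FinSupported 𝔸 t := by
  induction t with
  | @atom α a =>
    exact ⟨{⟨α, a⟩}, Set.finite_singleton _, fun π hπ => congrArg Raw.atom (hπ _ rfl)⟩
  | @abs α σ a t ih =>
    obtain ⟨S, hS, h⟩ := ih
    refine ⟨insert ⟨α, a⟩ S, hS.insert _, fun π hπ => ?_⟩
    have h1 : π • a = a := hπ ⟨α, a⟩ (Set.mem_insert _ _)
    have h2 : π • t = t := h π fun p hp => hπ p (Set.mem_insert_of_mem _ hp)
    change Raw.abs (π • a) (π • t) = _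
    rw [h1, h2]
  | tup t ih =>
    choose S hS h using ih
    refine ⟨⋃ l, S l, Set.finite_iUnion hS, fun π hπ => congrArg Raw.tup (funext fun l => ?_)⟩
    exact h l π fun p hp => hπ p (Set.mem_iUnion_of_mem l hp)
  | op i j t ih =>
    obtain ⟨S, hS, h⟩ := ih
    exact ⟨S, hS, fun π hπ => congrArg (Raw.op i j) (h π hπ)⟩

/-- Alpha-equivalence of raw terms. -/
inductive AlphaEq : ∀ {σ : NSort Sg.n A}, Raw 𝔸 Sg σ → Raw 𝔸 Sg σ → Prop
  | atom {α : A} (a : 𝔸 α) : AlphaEq (.atom a) (.atom a)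
  | abs {α : A} {σ : NSort Sg.n A} {a₁ a₂ : 𝔸 α} {t₁ t₂ : Raw 𝔸 Sg σ} (c : 𝔸 α)
      (hc₁ : c ≠ a₁) (hc₂ : c ≠ a₂) (ht₁ : Fresh c t₁) (ht₂ : Fresh c t₂)
      (h : AlphaEq (swap a₁ c • t₁) (swap a₂ c • t₂)) : AlphaEq (.abs a₁ t₁) (.abs a₂ t₂)
  | tup {k : ℕ} {σ : Fin k → NSort Sg.n A} {t₁ t₂ : ∀ l, Raw 𝔸 Sg (σ l)}
      (h : ∀ l, AlphaEq (t₁ l) (t₂ l)) : AlphaEq (.tup t₁) (.tup t₂)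
  | op (i : Fin Sg.n) (j : Fin (Sg.m i)) {t₁ t₂ : Raw 𝔸 Sg (Sg.arity i j)}
      (h : AlphaEq t₁ t₂) : AlphaEq (.op i j t₁) (.op i j t₂)

theorem AlphaEq.smul {σ : NSort Sg.n A} {t t' : Raw 𝔸 Sg σ} (h : AlphaEq t t') (π : SPerm 𝔸) :
    AlphaEq (π • t) (π • t') := by
  induction h with
  | atom a => exact .atom _
  | abs c hc₁ hc₂ ht₁ ht₂ h ih =>
    refine .abs (π • c) ?_ ?_ (ht₁.smul π) (ht₂.smul π) ?_
    · exact fun e => hc₁ (smul_left_cancel π e)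
    · exact fun e => hc₂ (smul_left_cancel π e)
    · rw [conj_swap_smul, conj_swap_smul] at ih
      exact ih
  | tup h ih => exact .tup ih
  | op i j h ih => exact .op i j ih

theorem AlphaEq.symm {σ : NSort Sg.n A} {t t' : Raw 𝔸 Sg σ} (h : AlphaEq t t') :
    AlphaEq t' t := by
  induction h with
  | atom a => exact .atom _
  | abs c hc₁ hc₂ ht₁ ht₂ h ih => exact .abs c hc₂ hc₁ ht₂ ht₁ ih
  | tup h ih => exact .tup ih
  | op i j h ih => exact .op i j ih

variable [∀ α, Infinite (𝔸 α)]

theorem AlphaEq.refl {σ : NSort Sg.n A} (t : Raw 𝔸 Sg σ) : AlphaEq t t := by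
  induction t with
  | atom a => exact .atom _
  | @abs α σ a t ih =>
    obtain ⟨c, hc, hct, -⟩ :=
      exists_fresh α (Set.finite_singleton a) t.finSupported t.finSupported t.finSupported
    exact .abs c hc hc hct hct (ih.smul _)
  | tup t ih => exact .tup ih
  | op i j t ih => exact .op i j ih

theorem swap_rename {σ : NSort Sg.n A} {α : A} {a c e : 𝔸 α} {t : Raw 𝔸 Sg σ} (hca : c ≠ a)
    (hea : e ≠ a) (hc : Fresh c t) (he : Fresh e t) :
    swap c e • swap a c • t = swap a e • t := by
  rw [conj_swap_smul, swap_smul_left, swap_smul_of_ne hca.symm hea.symm, swap_fresh hc he]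

theorem AlphaEq.trans {σ : NSort Sg.n A} {t t' t'' : Raw 𝔸 Sg σ} (h : AlphaEq t t')
    (h' : AlphaEq t' t'') : AlphaEq t t'' := by
  induction h with
  | atom a => exact h'
  | @abs α σ a₁ a₂ t₁ t₂ c hc₁ hc₂ ht₁ ht₂ h ih =>
    cases h' with
    | @abs _ _ _ a₃ _ t₃ d hd₂ hd₃ hdt₂ hdt₃ h' =>
      obtain ⟨e, he, het₁, het₂, het₃⟩ := exists_fresh α (Set.toFinite {a₁, a₂, a₃})
        t₁.finSupported t₂.finSupported t₃.finSupported
      simp only [Set.mem_insert_iff, Set.mem_singleton_iff, not_or] at he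
      obtain ⟨he₁, he₂, he₃⟩ := he
      refine .abs e he₁ he₃ het₁ het₃ ?_
      have h1 := h'.smul (swap d e)
      rw [swap_rename hd₂ he₂ hdt₂ het₂, swap_rename hd₃ he₃ hdt₃ het₃,
        ← swap_rename hc₂ he₂ ht₂ het₂] at h1
      have h2 := h1.smul (swap c e)
      rw [swap_swap_smul] at h2
      have h3 := (ih h2).smul (swap c e)
      rwa [swap_swap_smul, swap_rename hc₁ he₁ ht₁ het₁] at h3
  | tup h ih =>
    cases h' with
    | tup h' => exact .tup fun l => ih l (h' l)
  | op i j h ih =>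
    cases h' with
    | op _ _ h' => exact .op i j (ih h')

instance alphaSetoid (σ : NSort Sg.n A) : Setoid (Raw 𝔸 Sg σ) where
  r := AlphaEq
  iseqv := ⟨AlphaEq.refl, AlphaEq.symm, AlphaEq.trans⟩

instance alphaAction (σ : NSort Sg.n A) : MulAction (SPerm 𝔸) (Quotient (alphaSetoid (𝔸 := 𝔸) σ))
    where
  smul π := Quotient.map (fun t => π • t) fun _ _ h => AlphaEq.smul h π
  one_smul := by
    rintro ⟨t⟩
    exact congrArg (Quotient.mk _) (one_smul _ t)
  mul_smul := by
    rintro π ρ ⟨t⟩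
    exact congrArg (Quotient.mk _) (mul_smul π ρ t)

end Raw

variable [∀ α, Infinite (𝔸 α)]

variable (𝔸) in
/-- The nominal algebraic datatype of sort `σ`: alpha-equivalence classes of raw terms. -/
def Datatype (Sg : Signature A) (σ : NSort Sg.n A) : Nom 𝔸 where
  carrier := Quotient (Raw.alphaSetoid (𝔸 := 𝔸) σ)
  finSupported := by
    rintro ⟨t⟩
    obtain ⟨S, hS, h⟩ := t.finSupported
    exact ⟨S, hS, fun π hπ => congrArg (Quotient.mk _) (h π hπ)⟩

/-- The alpha-equivalence class of a raw term. -/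
def Raw.toDatatype {Sg : Signature A} {σ : NSort Sg.n A} (t : Raw 𝔸 Sg σ) : Datatype 𝔸 Sg σ :=
  Quotient.mk (Raw.alphaSetoid σ) t

/-- The interpretation `M⟦t⟧` of a raw term in a `Σ`-structure. -/
def SigmaStructure.eval {Sg : Signature A} (M : SigmaStructure 𝔸 Sg) :
    ∀ {σ : NSort Sg.n A}, Raw 𝔸 Sg σ → M.interp σ
  | _, .atom (α := α) a => (a : 𝔸 α)
  | _, .abs (α := α) (σ := σ) a t => Nom.absMk (α := α) (X := M.interp σ) a (M.eval t)
  | _, .tup (σ := σ) t => ((fun l => M.eval (t l)) : ∀ l, M.interp (σ l))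
  | _, .op i j t => Nom.fn (M.op i j) (M.eval t)

end NominalTerms

end

set_option linter.unusedSectionVars false

noncomputable section

namespace NominalTerms

open CategoryTheory

variable {A : Type u} {𝔸 : A → Type u} [∀ α, Infinite (𝔸 α)]

/-! Everything rests on evaluating raw terms. In any structure the value of a raw term depends only
on its alpha-class (`eval_eq_of_alphaEq`): evaluation is equivariant, hence preserves freshness, and
an abstraction ⟨a⟩x equals ⟨c⟩((c a)·x) for c fresh in x, which is the renaming in the abstraction
rule of alpha-equivalence.

For nominal terms the resulting map on alpha-classes is bijective. It is onto by leastness: the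
values of raw terms in the universe form a tuple closed under the defining operator, so they contain
the least tuple (`leastTuple_le_ntEval`). It is one-to-one because an abstraction is a partial
function on atoms: equal abstractions agree at an atom fresh for both bodies, which gives the
premise of the alpha-rule (`alphaEq_of_ntEval_eq`). This is the second claim.

Initiality then needs no separate recursion principle. A T-algebra is read as a structure, and the
homomorphism into it sends a nominal term to its alpha-class and evaluates that class. Since every
nominal term is the value of a raw term, both the homomorphism square and uniqueness reduce to the
fact that maps respecting the operations preserve values of raw terms (`sortMap_eval`). -/

/-! ## Bijective equivariant functions are isomorphisms -/

/-- A bijective equivariant function is an isomorphism of nominal sets. -/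
def Nom.isoOfBijective {X Y : Nom 𝔸} (f : X ⟶ Y) (hf : Function.Bijective (Nom.fn f)) :
    X ≅ Y where
  hom := f
  inv :=
    { toFun := (Equiv.ofBijective _ hf).symm
      map_smul' := fun π y => by
        obtain ⟨x, rfl⟩ := hf.2 y
        rw [Equiv.symm_apply_eq]
        refine (map_smul (Nom.fn f) π x).symm.trans (congrArg (Nom.fn f) ?_)
        exact congrArg (π • ·) ((Equiv.ofBijective _ hf).symm_apply_apply x).symm }
  hom_inv_id := MulActionHom.ext fun x => (Equiv.ofBijective _ hf).symm_apply_apply x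
  inv_hom_id := MulActionHom.ext fun y => (Equiv.ofBijective _ hf).apply_symm_apply y

theorem Nom.absMk_swap {α : A} {X : Nom 𝔸} {a b : 𝔸 α} {x : X} (hb : Fresh b x) :
    Nom.absMk b (swap b a • x) = Nom.absMk a x :=
  Subtype.ext (absSet_swap hb)

/-! ## Interpretation of raw terms -/

namespace SigmaStructure

variable {Sg : Signature A} (M N : SigmaStructure 𝔸 Sg)

theorem eval_smul {σ : NSort Sg.n A} (π : SPerm 𝔸) (t : Raw 𝔸 Sg σ) :
    M.eval (π • t) = π • M.eval t := by
  induction t with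
  | atom a => rfl
  | @abs α σ a t ih =>
    refine Eq.trans ?_ (Nom.smul_absMk (X := M.interp σ) π a (M.eval t)).symm
    exact congrArg (Nom.absMk (X := M.interp σ) (π • a)) ih
  | tup t ih => exact funext ih
  | op i j t ih =>
    exact (congrArg (Nom.fn (M.op i j)) ih).trans (map_smul (Nom.fn (M.op i j)) π (M.eval t))

/-- Interpretation of raw terms as an equivariant function. -/
def evalHom (σ : NSort Sg.n A) : Raw 𝔸 Sg σ →[SPerm 𝔸] M.interp σ where
  toFun := M.eval
  map_smul' := M.eval_smul

/-- In the abstraction case both sides are re-expressed with the common bound atom `c`; the bodies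
then agree by induction. -/
theorem eval_eq_of_alphaEq {σ : NSort Sg.n A} {t t' : Raw 𝔸 Sg σ} (h : Raw.AlphaEq t t') :
    M.eval t = M.eval t' := by
  induction h with
  | atom a => rfl
  | @abs α σ a₁ a₂ t₁ t₂ c hc₁ hc₂ ht₁ ht₂ h ih =>
    rw [eval_smul, eval_smul, swap_comm a₁, swap_comm a₂] at ih
    -- Freshness of `c` is known for the raw bodies; equivariance of evaluation passes it to their
    -- values.
    refine (Nom.absMk_swap (ht₁.map (M.evalHom σ))).symm.trans ?_
    exact (congrArg (Nom.absMk (X := M.interp σ) c) ih).trans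
      (Nom.absMk_swap (ht₂.map (M.evalHom σ)))
  | tup h ih => exact funext ih
  | op i j h ih => exact congrArg (Nom.fn (M.op i j)) ih

/-- The interpretation of raw terms, on alpha-equivalence classes. -/
def evalClass (σ : NSort Sg.n A) : Datatype 𝔸 Sg σ ⟶ M.interp σ where
  toFun := Quotient.lift M.eval fun _ _ h => M.eval_eq_of_alphaEq h
  map_smul' := by
    rintro π ⟨t⟩
    exact M.eval_smul π t

variable {M N}

/-- Families of maps that commute with the interpretations of raw terms of base sorts commute with
the interpretations of all raw terms. -/
theorem sortMap_eval (f : ∀ i, M.carrier i ⟶ N.carrier i)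
    (hf : ∀ i j (t : Raw 𝔸 Sg (Sg.arity i j)),
      Nom.fn (sortMap f (Sg.arity i j)) (M.eval t) = N.eval t →
        Nom.fn (f i) (M.eval (.op i j t)) = N.eval (.op i j t))
    {σ : NSort Sg.n A} (t : Raw 𝔸 Sg σ) : Nom.fn (sortMap f σ) (M.eval t) = N.eval t := by
  induction t with
  | atom a => rfl
  | @abs α σ a t ih =>
    refine (Nom.absMap_mk (sortMap f σ) a (M.eval t)).trans ?_
    exact congrArg (Nom.absMk (X := N.interp σ) a) ih
  | tup t ih => exact funext ih
  -- Giving `hf` access to the inductive equation covers both later uses: an algebra homomorphism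
  -- needs it, while `ntDesc` satisfies the conclusion outright.
  | op i j t ih => exact hf i j t ih

end SigmaStructure

/-! ## Nominal terms -/

section NominalTerms

variable {Sg : Signature A}

/-- On abstractions `ntVal` is defined through a chosen representative; renaming by a fresh atom
does not change the result, so any representative computes it. -/
theorem ntVal_absMk {α : A} {σ : NSort Sg.n A} (a : 𝔸 α) (x : sortObj (ntBase 𝔸 Sg) σ) :
    ntVal Sg (.abs α σ) (Nom.absMk a x) = Univ.absOf a (ntVal Sg σ x) := by
  refine Nom.absLift_mk (F := fun a x => Univ.absOf a (ntVal Sg σ x)) (fun a b x hb => ?_) a x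
  rw [map_smul, Univ.absOf_swap (hb.map (ntVal Sg σ))]

variable (𝔸 Sg) in
/-- The interpretation of raw terms as nominal terms, with values in the universe. -/
def ntEval (σ : NSort Sg.n A) : Raw 𝔸 Sg σ →[SPerm 𝔸] Univ 𝔸 :=
  (ntVal Sg σ).comp ((NT 𝔸 Sg).evalHom σ)

theorem ntEval_abs {α : A} {σ : NSort Sg.n A} (a : 𝔸 α) (t : Raw 𝔸 Sg σ) :
    ntEval 𝔸 Sg _ (.abs a t) = Univ.absOf a (ntEval 𝔸 Sg σ t) :=
  ntVal_absMk a _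

/-! ### Injectivity up to alpha-equivalence -/

/-- Both abstractions are partial functions defined at every atom fresh for their bodies, so equal
ones may be compared at `c`. This is the concretion of an abstraction at a fresh atom. -/
theorem Univ.absOf_apply_eq {α : A} {a b c : 𝔸 α} {x y : Univ 𝔸}
    (h : Univ.absOf a x = Univ.absOf b y) (hx : Fresh c x) (hy : Fresh c y) :
    swap c a • x = swap c b • y := by
  -- Domains and graphs are generalised to variables, so that the equation can be eliminated despite
  -- values depending on proofs of membership in the domain.
  have key : ∀ {d d' : 𝔸 α → Prop} {g : ∀ b, d b → Univ 𝔸} {g' : ∀ b, d' b → Univ 𝔸},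
      Univ.pfun d g = Univ.pfun d' g' → ∀ (hd : d c) (hd' : d' c), g c hd = g' c hd' := by
    intro d d' g g' e hd hd'
    cases e
    rfl
  exact key h (Or.inr hx) (Or.inr hy)

/-- Induction on `t`, with `t'` of the same sort arbitrary: sharing a sort forces both terms to have
the same outermost constructor, except that the function symbols remain to be compared. -/
theorem alphaEq_of_ntEval_eq {σ : NSort Sg.n A} {t t' : Raw 𝔸 Sg σ}
    (h : ntEval 𝔸 Sg σ t = ntEval 𝔸 Sg σ t') : Raw.AlphaEq t t' := by
  induction t with
  | atom a =>
    cases t' with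
    | atom b =>
      change Univ.atom a = Univ.atom b at h
      cases h
      exact .atom a
  | @abs α σ a t ih =>
    cases t' with
    | abs b t' =>
      rw [ntEval_abs, ntEval_abs] at h
      -- Only two terms have to be avoided; the third argument repeats `t` as a filler.
      obtain ⟨c, hc, hct, hct', -⟩ := exists_fresh α (Set.toFinite {a, b})
        t.finSupported t'.finSupported t.finSupported
      simp only [Set.mem_insert_iff, Set.mem_singleton_iff, not_or] at hc
      refine .abs c hc.1 hc.2 hct hct' ?_
      have h1 := Univ.absOf_apply_eq h (hct.map _) (hct'.map _)
      -- The inductive hypothesis concerns `t` itself, not its renaming, so the swap of `c` and `a`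
      -- is moved to the other side here and undone afterwards by equivariance of alpha-equivalence.
      have h2 : ntEval 𝔸 Sg σ t = ntEval 𝔸 Sg σ (swap c a • swap c b • t') := by
        rw [map_smul, map_smul, ← h1, swap_swap_smul]
      have h3 := (ih h2).smul (swap c a)
      rwa [swap_swap_smul, swap_comm c a, swap_comm c b] at h3
  | tup t ih =>
    cases t' with
    | tup t' =>
      refine .tup fun l => ih l ?_
      exact congrFun (eq_of_heq (Univ.tup.inj h).2) l
  | op i j t ih =>
    cases t' with
    | op _ j' t' =>
      obtain ⟨h1, h2⟩ := Univ.inj.inj h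
      -- Injections in the universe are tagged by natural numbers, so equal tags identify the
      -- function symbols.
      obtain rfl := Fin.ext h1
      exact .op i j (ih h2)

/-! ### Surjectivity from leastness -/

/-- Each sort former is matched by a raw term former with the same effect on values. Hence the tuple
of value sets is closed under the operator defining nominal terms. -/
theorem sortSet_ntEval (σ : NSort Sg.n A) :
    sortSet (fun i => Set.range (ntEval 𝔸 Sg (.base i))) σ ⊆ Set.range (ntEval 𝔸 Sg σ) := by
  induction σ with
  | base i => exact subset_rfl
  | atom α =>
    rintro u ⟨a, rfl⟩
    exact ⟨.atom a, rfl⟩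
  | abs α σ ih =>
    rintro u ⟨a, x, hx, rfl⟩
    obtain ⟨t, rfl⟩ := ih hx
    exact ⟨.abs a t, ntEval_abs a t⟩
  | prod k σ ih =>
    rintro u ⟨v, hv, rfl⟩
    choose t ht using fun l => ih l (hv l)
    exact ⟨.tup t, congrArg Univ.tup (funext ht)⟩

theorem leastTuple_le_ntEval :
    leastTuple 𝔸 Sg ≤ fun i => Set.range (ntEval 𝔸 Sg (.base i)) := by
  -- A least fixed point lies below every pre-fixed point, so closure under the operator suffices.
  apply OrderHom.lfp_le
  rintro i u ⟨j, s, hs, rfl⟩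
  obtain ⟨t, rfl⟩ := sortSet_ntEval _ hs
  exact ⟨.op i j t, rfl⟩

/-- This serves as the induction principle for nominal terms: leastness settles the base sorts, and
the other sorts follow by choosing raw terms for the components. -/
theorem NT_eval_surjective (σ : NSort Sg.n A) :
    Function.Surjective ((NT 𝔸 Sg).eval (σ := σ)) := by
  induction σ with
  | base i =>
    rintro ⟨u, hu⟩
    obtain ⟨t, ht⟩ := leastTuple_le_ntEval i hu
    exact ⟨t, Subtype.ext ht⟩
  | atom α => exact fun a => ⟨.atom a, rfl⟩
  | abs α σ ih =>
    intro C
    obtain ⟨a, x, rfl⟩ := Nom.exists_absMk C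
    obtain ⟨t, rfl⟩ := ih x
    exact ⟨.abs a t, rfl⟩
  | prod k σ ih =>
    intro x
    choose t ht using fun l => ih l (x l)
    exact ⟨.tup t, funext ht⟩

theorem NT_evalClass_bijective (σ : NSort Sg.n A) :
    Function.Bijective (Nom.fn ((NT 𝔸 Sg).evalClass σ)) := by
  constructor
  · rintro ⟨t⟩ ⟨t'⟩ h
    -- Equality is only pushed forward into the universe, so injectivity of `ntVal` need not be
    -- known.
    exact Quotient.sound (alphaEq_of_ntEval_eq (congrArg (ntVal Sg σ) h))
  · intro x
    obtain ⟨t, rfl⟩ := NT_eval_surjective σ x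
    exact ⟨t.toDatatype, rfl⟩

variable (𝔸) in
/-- Nominal terms are the alpha-equivalence classes of raw terms. -/
def ntIso (σ : NSort Sg.n A) : (NT 𝔸 Sg).interp σ ≅ Datatype 𝔸 Sg σ :=
  (Nom.isoOfBijective _ (NT_evalClass_bijective σ)).symm

theorem ntIso_eval {σ : NSort Sg.n A} (t : Raw 𝔸 Sg σ) :
    Nom.fn (ntIso 𝔸 σ).hom ((NT 𝔸 Sg).eval t) = t.toDatatype :=
  (Equiv.ofBijective _ (NT_evalClass_bijective σ)).symm_apply_apply t.toDatatype

/-! ## Initiality -/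

/-- The inclusion of a summand into a coproduct. -/
def Nom.sumInj {J : Type} (X : J → Nom 𝔸) (j : J) : X j ⟶ Nom.sum X where
  toFun x := ⟨j, x⟩
  map_smul' _ _ := rfl

/-- The `Σ`-structure given by a `T`-algebra. -/
def SigmaStructure.ofAlgebra (B : Endofunctor.Algebra (algFunctor 𝔸 Sg)) :
    SigmaStructure 𝔸 Sg where
  carrier := B.a
  op i j := Nom.sumInj (fun j => sortObj B.a (Sg.arity i j)) j ≫ B.str i

/-- The interpretation of nominal terms in a `Σ`-structure. -/
def ntDesc (M : SigmaStructure 𝔸 Sg) (i : Fin Sg.n) : (NT 𝔸 Sg).carrier i ⟶ M.carrier i :=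
  (ntIso 𝔸 (.base i)).hom ≫ M.evalClass (.base i)

theorem ntDesc_eval (M : SigmaStructure 𝔸 Sg) (i : Fin Sg.n) (t : Raw 𝔸 Sg (.base i)) :
    Nom.fn (ntDesc M i) ((NT 𝔸 Sg).eval t) = M.eval t :=
  congrArg (Nom.fn (M.evalClass (.base i))) (ntIso_eval t)

theorem sortMap_ntDesc_eval (M : SigmaStructure 𝔸 Sg) {σ : NSort Sg.n A} (t : Raw 𝔸 Sg σ) :
    Nom.fn (sortMap (ntDesc M) σ) ((NT 𝔸 Sg).eval t) = M.eval t :=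
  SigmaStructure.sortMap_eval _ (fun i j t _ => ntDesc_eval M i (.op i j t)) t

/-- The unique homomorphism from nominal terms to a `T`-algebra. -/
def ntAlgebraHom (B : Endofunctor.Algebra (algFunctor 𝔸 Sg)) : (NT 𝔸 Sg).toAlgebra ⟶ B where
  f := ntDesc (SigmaStructure.ofAlgebra B)
  h := by
    funext i
    apply MulActionHom.ext
    rintro ⟨j, x⟩
    -- With the argument named by `t`, both legs of the square become the value of `f_ij(t)` in the
    -- target.
    obtain ⟨t, rfl⟩ := NT_eval_surjective (Sg.arity i j) x
    refine Eq.trans ?_ (ntDesc_eval (SigmaStructure.ofAlgebra B) i (.op i j t)).symm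
    exact congrArg (Nom.fn ((SigmaStructure.ofAlgebra B).op i j))
      (sortMap_ntDesc_eval (SigmaStructure.ofAlgebra B) t)

/-- This gives uniqueness: the right-hand side does not mention `g`, and every nominal term is the
value of a raw term. -/
theorem algebraHom_eval {B : Endofunctor.Algebra (algFunctor 𝔸 Sg)}
    (g : (NT 𝔸 Sg).toAlgebra ⟶ B) {σ : NSort Sg.n A} (t : Raw 𝔸 Sg σ) :
    Nom.fn (sortMap g.f σ) ((NT 𝔸 Sg).eval t) = (SigmaStructure.ofAlgebra B).eval t := by
  refine SigmaStructure.sortMap_eval (M := NT 𝔸 Sg) (N := SigmaStructure.ofAlgebra B)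
    (fun i => g.f i) (fun i j t ht => ?_) t
  -- The homomorphism square of `g`, evaluated at the `j`-th injection of the value of `t`.
  have h := congrArg (fun k => Nom.fn k (⟨j, (NT 𝔸 Sg).eval t⟩ :
    Σ j, sortObj (NT 𝔸 Sg).carrier (Sg.arity i j))) (congrFun g.h i)
  exact h.symm.trans (congrArg (Nom.fn ((SigmaStructure.ofAlgebra B).op i j)) ht)

variable (𝔸 Sg) in
/-- The algebra of nominal terms is initial. -/
def ntIsInitial : Limits.IsInitial (NT 𝔸 Sg).toAlgebra :=
  Limits.IsInitial.ofUniqueHom ntAlgebraHom fun B g => by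
    apply Endofunctor.Algebra.Hom.ext
    funext i
    apply MulActionHom.ext
    intro x
    obtain ⟨t, rfl⟩ := NT_eval_surjective (.base i) x
    exact (algebraHom_eval g t).trans (ntDesc_eval (SigmaStructure.ofAlgebra B) i t).symm

end NominalTerms

end NominalTerms

end

open CategoryTheory NominalTerms in
theorem mainTheorem6 {A : Type u} [Countable A] (𝔸 : A → Type u)
    [∀ α, Countable (𝔸 α)] [∀ α, Infinite (𝔸 α)] (Sg : Signature A) :
    Nonempty (Limits.IsInitial (NT 𝔸 Sg).toAlgebra) ∧
    ∃ φ : ∀ σ : NSort Sg.n A, (NT 𝔸 Sg).interp σ ≅ Datatype 𝔸 Sg σ,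
      ∀ (σ : NSort Sg.n A) (t : Raw 𝔸 Sg σ),
        Nom.fn (φ σ).hom ((NT 𝔸 Sg).eval t) = t.toDatatype := by
  exact ⟨⟨ntIsInitial 𝔸 Sg⟩, ntIso 𝔸, fun _ t => ntIso_eval t⟩
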